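/- Let $K$ be an algebraically closed field, complete with respect to a non-trivial non-archimedean absolute value $|\cdot|$. Let $d\ge 2$ be an integer, and assume that either $\operatorname{char} K=0$ or $\operatorname{char} K>d$. Put $$\epsilon=\min\{|m|^d : 1\le m\le d\},$$ where $|m|$ is the absolute value of the image of the integer $m$ in $K$; thus $0<\epsilon\le 1$. Let $\varphi\in K(z)$ be a rational function of degree $d$, regarded as a map $\mathbb{P}^1(K)\to\mathbb{P}^1(K)$ with $\mathbb{P}^1(K)=K\cup\{\infty\}$, and suppose that $\varphi(\infty)=\infty$. Let $a\in K$ be a point that is not a pole of $\varphi$. Let $r\in(0,\infty]$ be the radius of the largest punctured open disk $\{z\in K : 0<|z-a|<r\}$ about $a$ that is disjoint from $\varphi^{-1}(\{\varphi(a),\infty\})$ (so $r=\infty$ if $\varphi$ takes the values $\varphi(a)$ and $\infty$ at no point of $K$ other than $a$). Then there is a critical point $\beta$ of $\varphi$, i.e. a point $\beta\in K$ that is not a pole of $\varphi$ and satisfies $\varphi'(\beta)=0$, such that $$|\varphi(\beta)-\varphi(a)|\le \epsilon^{-1}\, r\, |\varphi'(a)|,$$ where the right-hand side is read as $0$ if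 $r=\infty$ and $\varphi'(a)=0$. -/

import Mathlib

open scoped ENNReal

namespace RationalMap

noncomputable section

variable {K : Type*} [Field K]

/-- The degree of a rational function `f / g` in lowest terms, as a map of the projective line:
`max (deg f) (deg g)`. -/
def degree (φ : RatFunc K) : ℕ :=
  max φ.num.natDegree φ.denom.natDegree

/-- The value of a rational function at a point of `K`
(the junk value `0` is taken at poles). -/
def value (φ : RatFunc K) (z : K) : K :=
  φ.eval (RingHom.id K) z

open Classical in
/-- The self-map of the projective line `ℙ¹(K) = K ∪ {∞}` defined by a rational function `f / g`
in lowest terms. At `∞`, if `deg f ≤ deg g`, the value is the coefficient of `f` in degree `deg g`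
divided by the leading coefficient of `g`. -/
def toMap (φ : RatFunc K) : OnePoint K → OnePoint K
  | OnePoint.infty => if φ.denom.natDegree < φ.num.natDegree then OnePoint.infty
      else ((φ.num.coeff φ.denom.natDegree / φ.denom.leadingCoeff : K) : OnePoint K)
  | OnePoint.some z => if φ.denom.eval z = 0 then OnePoint.infty else ((value φ z : K) : OnePoint K)

end

noncomputable section

variable (K : Type*) [NormedField K]

/-- The constant `ε = min {|m|^d : 1 ≤ m ≤ d}`, where `|m|` is the absolute value in `K` of the
integer `m`. -/
def epsilon (d : ℕ) (hd : 2 ≤ d) : ℝ :=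
  (Finset.Icc 1 d).inf' (Finset.nonempty_Icc.mpr (by omega)) fun m : ℕ => ‖(m : K)‖ ^ d

variable {K}

/-- The open disk of radius `ρ ∈ [0, ∞]` about `a`, with `a` removed, as a subset of `ℙ¹(K)`;
for `ρ = ∞` it is `K` without `a`. -/
def puncturedDisk (a : K) (ρ : ℝ≥0∞) : Set (OnePoint K) :=
  (fun z : K => (z : OnePoint K)) '' (Metric.eball a ρ \ {a})

end

end RationalMap

namespace RationalMap

open Polynomial Filter Topology

/-! ### Density of the value group and choice of generic radii. -/

section Norms

variable {K : Type*} [NontriviallyNormedField K] [IsAlgClosed K]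


/-! Put `ψ = φ - φ(a) = f / g`, let `A = f' g - f g'`, so `ψ' = A / g²`, and let `c ≠ a` be a
nearest other zero or pole of `ψ`. If the theorem fails, all critical values of `ψ` lie outside a
closed disk about `0` whose radius `ρ` exceeds `ε⁻¹ |c - a| |ψ'(a)|`. With `μ = min |m|` over `1 ≤ m
≤ d`, the bound `μ² ρ ≤ |c - a| |ψ'(a)|` of `sq_mul_le_norm_sub_mul` contradicts this, because `ε =
μ ^ d ≤ μ²`.

To prove that bound, move from the fibre over `0` to the fibre over a generic `t` with `|t|`
slightly above `ρ`. Around each `b` over `t` there is a disk of radius `δ`, free of critical points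
and poles, on which `ψ - t` has Gauss norm exactly `|t|` (`exists_radius_of_generic`). There `|ψ'|`
is constant, and integrating the power series costs at most a factor `μ`, so `|ψ'(b)| δ ≥ μ |t|`
(`mul_norm_coeff_le_norm_coeff_one`). This bounds suitable rational functions whose denominators
involve `ψ'` at all points over `t`. The maximum principle `norm_eval_le_of_eventually`, proved by
comparing products over whole fibres by resultants, carries the bounds back to `a`. -/

theorem exists_lt_norm_lt_of_isAlgClosed {a b : ℝ} (ha : 0 ≤ a) (hab : a < b) :
    ∃ x : K, a < ‖x‖ ∧ ‖x‖ < b := by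
  obtain ⟨a', h1, h2⟩ := exists_between hab
  have ha' : 0 < a' := ha.trans_lt h1
  obtain ⟨c, hc⟩ := NontriviallyNormedField.non_trivial (α := K)
  have hq : 1 < b / a' := by rwa [one_lt_div ha']
  obtain ⟨n, hn⟩ := pow_unbounded_of_one_lt ‖c‖ hq
  have hn0 : 0 < n := by
    rcases Nat.eq_zero_or_pos n with rfl | h
    · simp at hn; linarith
    · exact h
  -- A high root of `c` has norm in `(1, b / a')`, so its integer powers cannot jump over the
  -- interval `(a', b)`.
  obtain ⟨x, hx⟩ := IsAlgClosed.exists_pow_nat_eq c hn0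
  rw [← hx, norm_pow] at hn hc
  have hx1 : 1 < ‖x‖ := by
    by_contra! h
    exact absurd (pow_le_one₀ (n := n) (norm_nonneg _) h) (not_le.2 hc)
  have hxb : ‖x‖ < b / a' := lt_of_pow_lt_pow_left₀ n (by positivity) hn
  obtain ⟨k, hk1, hk2⟩ := exists_mem_Ico_zpow ha' hx1
  refine ⟨x ^ (k + 1), ?_, ?_⟩
  · rw [norm_zpow]; exact h1.trans hk2
  · rw [norm_zpow, zpow_add_one₀ (by positivity)]
    calc ‖x‖ ^ k * ‖x‖ ≤ a' * ‖x‖ := by gcongr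
      _ < a' * (b / a') := by gcongr
      _ = b := by field_simp

/-- Genericity conditions exclude finitely many radii; density of the value group provides an
element whose norm satisfies them all. -/
theorem exists_norm_of_eventually_nhdsGT {a : ℝ} (ha : 0 ≤ a) {p : ℝ → Prop}
    (hp : ∀ᶠ x in 𝓝[>] a, p x) : ∃ x : K, a < ‖x‖ ∧ p ‖x‖ := by
  obtain ⟨b, hb, h⟩ := mem_nhdsGT_iff_exists_Ioo_subset.1 hp
  obtain ⟨x, h1, h2⟩ := exists_lt_norm_lt_of_isAlgClosed (K := K) ha hb
  exact ⟨x, h1, h ⟨h1, h2⟩⟩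

end Norms

theorem eventually_nhdsGT_mul_ne (a : ℝ) {r s : ℝ} (hr : r ≠ 0) :
    ∀ᶠ x in 𝓝[>] a, x * r ≠ s := by
  have h : ∀ᶠ x in 𝓝[>] a, x ≠ s / r := by
    rcases le_or_gt (s / r) a with h | h
    · filter_upwards [self_mem_nhdsWithin] with x hx
      exact (h.trans_lt hx).ne'
    · filter_upwards [Ioo_mem_nhdsGT h] with x hx
      exact hx.2.ne
  filter_upwards [h] with x hx h'
  exact hx (by rw [← h']; field_simp)

theorem eventually_nhdsGT_mul_lt {a r s : ℝ} (h : a * r < s) :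
    ∀ᶠ x in 𝓝[>] a, x * r < s := by
  have : Tendsto (fun x : ℝ => x * r) (𝓝[>] a) (𝓝 (a * r)) :=
    (Continuous.tendsto (by fun_prop) a).mono_left nhdsWithin_le_nhds
  exact this.eventually_lt_const h

/-! ### Gauss norms, Taylor expansions and division of power series. -/

section Ultrametric

variable {K : Type*} [NontriviallyNormedField K] [IsUltrametricDist K]

theorem norm_sub_le_max_norm (x y : K) : ‖x - y‖ ≤ max ‖x‖ ‖y‖ := by
  simpa [sub_eq_add_neg] using IsUltrametricDist.norm_add_le_max x (-y)

theorem norm_sub_eq_max_of_ne {x y : K} (h : ‖x‖ ≠ ‖y‖) : ‖x - y‖ = max ‖x‖ ‖y‖ := by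
  rw [sub_eq_add_neg, IsUltrametricDist.norm_add_eq_max_of_norm_ne_norm (by simpa using h),
    norm_neg]

/-- Division by a power series whose constant term dominates on the disk of radius `δ`. -/
theorem norm_coeff_mul_le_of_mul {c g : PowerSeries K} {δ C : ℝ} (hδ : 0 ≤ δ)
    (hg : ∀ n, ‖PowerSeries.coeff n g‖ * δ ^ n ≤ ‖PowerSeries.coeff 0 g‖)
    (h : ∀ n, ‖PowerSeries.coeff n (c * g)‖ * δ ^ n ≤ C) (n : ℕ) :
    ‖PowerSeries.coeff n c‖ * δ ^ n * ‖PowerSeries.coeff 0 g‖ ≤ C := by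
  induction n using Nat.strong_induction_on with
  | _ n ih =>
    have hC : 0 ≤ C := le_trans (by positivity) (h 0)
    have hn := PowerSeries.coeff_mul n c g
    -- Solve for `c_n g_0`: every other term of the convolution involves some `c_i` with `i < n`.
    rw [← Finset.add_sum_erase _ _ (show (n, 0) ∈ Finset.HasAntidiagonal.antidiagonal n by simp),
      ← sub_eq_iff_eq_add] at hn
    have key : ‖(PowerSeries.coeff n c * PowerSeries.coeff 0 g) * 1‖ * δ ^ n ≤ C := by
      rw [mul_one, ← hn]
      rcases eq_or_ne (δ ^ n) 0 with h0 | h0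
      · rw [h0, mul_zero]; exact hC
      have hpos : 0 < δ ^ n := lt_of_le_of_ne (by positivity) h0.symm
      rw [← le_div_iff₀ hpos]
      refine (norm_sub_le_max_norm _ _).trans (max_le ?_ ?_)
      · rw [le_div_iff₀ hpos]; exact h n
      · refine IsUltrametricDist.norm_sum_le_of_forall_le_of_nonneg (by positivity) fun p hp => ?_
        rw [le_div_iff₀ hpos]
        simp only [Finset.mem_erase, Finset.HasAntidiagonal.mem_antidiagonal, ne_eq] at hp
        have hp1 : p.1 < n := by
          rcases Nat.lt_or_ge p.1 n with h1 | h1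
          · exact h1
          · exact absurd (Prod.ext (by simp; omega) (by simp; omega)) hp.1
        calc ‖PowerSeries.coeff p.1 c * PowerSeries.coeff p.2 g‖ * δ ^ n
            = (‖PowerSeries.coeff p.1 c‖ * δ ^ p.1) *
              (‖PowerSeries.coeff p.2 g‖ * δ ^ p.2) := by
              rw [← hp.2, pow_add, norm_mul]; ring
          _ ≤ (‖PowerSeries.coeff p.1 c‖ * δ ^ p.1) * ‖PowerSeries.coeff 0 g‖ := by
              gcongr; exact hg _
          _ ≤ C := ih _ hp1
    rw [mul_one, norm_mul] at key
    linarith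

/-- If neither `g` nor the numerator of `(F / g)'` vanishes on the disk of radius `δ` about `0`,
then the linear coefficient of `F` controls all the others, up to the absolute values of the
integers up to the degree. -/
theorem mul_norm_coeff_le_norm_coeff_one {F g : K[X]} {d : ℕ} {δ μ : ℝ} (hδ : 0 < δ)
    (hμ : 0 ≤ μ) (hμd : ∀ n : ℕ, 1 ≤ n → n ≤ d → μ ≤ ‖(n : K)‖)
    (hF0 : F.coeff 0 = 0) (hFd : F.natDegree ≤ d) (hg0 : g.coeff 0 ≠ 0)
    (hg : ∀ n, ‖g.coeff n‖ * δ ^ n ≤ ‖g.coeff 0‖)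
    (hA : ∀ n, ‖(derivative F * g - F * derivative g).coeff n‖ * δ ^ n ≤
      ‖(derivative F * g - F * derivative g).coeff 0‖) (n : ℕ) :
    μ * (‖F.coeff n‖ * δ ^ n) ≤ ‖F.coeff 1‖ * δ := by
  have hg0' : 0 < ‖g.coeff 0‖ := norm_pos_iff.2 hg0
  -- `c` is the expansion of `F / g` at `0`. Since `c' g²` is the Wronskian, dividing twice by `g`
  -- bounds the coefficients of `c'` (`s1`, `s2`), and integrating bounds those of `c`.
  obtain ⟨c, hcg⟩ : ∃ c : PowerSeries K, c * (g : PowerSeries K) = F := by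
    refine ⟨(F : PowerSeries K) * (g : PowerSeries K)⁻¹, ?_⟩
    rw [mul_assoc, PowerSeries.inv_mul_cancel, mul_one]
    simpa using hg0
  set D := PowerSeries.derivative K with hD
  have hD1 : D c * (g : PowerSeries K) + c * D (g : PowerSeries K) = D (F : PowerSeries K) := by
    rw [← hcg, Derivation.leibniz, smul_eq_mul, smul_eq_mul]; ring
  have hDc : D c * (g : PowerSeries K) * (g : PowerSeries K) = ((derivative F * g - F * derivative g : K[X]) : PowerSeries K) := by
    have e1 : D (F : PowerSeries K) = ((derivative F : K[X]) : PowerSeries K) :=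
      PowerSeries.derivative_coe F
    have e2 : D (g : PowerSeries K) = ((derivative g : K[X]) : PowerSeries K) :=
      PowerSeries.derivative_coe g
    push_cast
    rw [← e1, ← e2, ← hD1, ← hcg]
    ring
  have hA0 : (derivative F * g - F * derivative g).coeff 0 = F.coeff 1 * g.coeff 0 := by
    simp [mul_coeff_zero, hF0, coeff_derivative]
  have hgP : ∀ n, ‖PowerSeries.coeff n (g : PowerSeries K)‖ * δ ^ n ≤
      ‖PowerSeries.coeff 0 (g : PowerSeries K)‖ := fun n => by
    simpa only [Polynomial.coeff_coe] using hg n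
  have s1 := norm_coeff_mul_le_of_mul (c := D c * (g : PowerSeries K)) hδ.le hgP
    (C := ‖F.coeff 1‖ * ‖g.coeff 0‖) (fun n => by
      rw [hDc, Polynomial.coeff_coe]; rw [← norm_mul, ← hA0]; exact hA n)
  simp only [Polynomial.coeff_coe] at s1
  have s2 := norm_coeff_mul_le_of_mul (c := D c) hδ.le hgP (C := ‖F.coeff 1‖)
    (fun n => le_of_mul_le_mul_right (s1 n) hg0')
  simp only [Polynomial.coeff_coe] at s2
  have hc0 : PowerSeries.coeff 0 c = 0 := by
    have := congrArg (PowerSeries.coeff 0) hcg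
    rw [PowerSeries.coeff_zero_eq_constantCoeff_apply, map_mul,
      ← PowerSeries.coeff_zero_eq_constantCoeff_apply,
      ← PowerSeries.coeff_zero_eq_constantCoeff_apply, Polynomial.coeff_coe,
      Polynomial.coeff_coe, hF0] at this
    exact (mul_eq_zero.1 this).resolve_right hg0
  have hcn : ∀ i ≤ d, μ * (‖PowerSeries.coeff i c‖ * δ ^ i) * ‖g.coeff 0‖ ≤ ‖F.coeff 1‖ * δ := by
    rintro (_ | i) hi
    · rw [hc0]; simp; positivity
    · have h2 := s2 i
      rw [hD, PowerSeries.coeff_derivative, norm_mul] at h2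
      have h3 := hμd (i + 1) (by omega) hi
      push_cast at h3
      calc μ * (‖PowerSeries.coeff (i + 1) c‖ * δ ^ (i + 1)) * ‖g.coeff 0‖
          ≤ ‖(i + 1 : K)‖ * (‖PowerSeries.coeff (i + 1) c‖ * δ ^ (i + 1)) * ‖g.coeff 0‖ := by
            gcongr
        _ = (‖PowerSeries.coeff (i + 1) c‖ * ‖(i + 1 : K)‖ * δ ^ i * ‖g.coeff 0‖) * δ := by ring
        _ ≤ ‖F.coeff 1‖ * δ := by gcongr
  -- Although `c` is an infinite series, only its coefficients up to `d` matter for `F = c g`, so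
  -- only integers up to `d` are divided by.
  rcases Nat.lt_or_ge d n with hn | hn
  · rw [coeff_eq_zero_of_natDegree_lt (hFd.trans_lt hn)]; simp; positivity
  have hFn : F.coeff n = ∑ p ∈ Finset.HasAntidiagonal.antidiagonal n,
      PowerSeries.coeff p.1 c * g.coeff p.2 := by
    rw [← Polynomial.coeff_coe, ← hcg, PowerSeries.coeff_mul]
    simp only [Polynomial.coeff_coe]
  obtain ⟨p, hp, hle⟩ := IsUltrametricDist.exists_norm_finsetSum_le_of_nonempty
    (show (Finset.HasAntidiagonal.antidiagonal n).Nonempty from ⟨(n, 0), by simp⟩)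
    (fun p : ℕ × ℕ => PowerSeries.coeff p.1 c * g.coeff p.2)
  rw [← hFn] at hle
  have hpn : p.1 + p.2 = n := by simpa using hp
  calc μ * (‖F.coeff n‖ * δ ^ n)
      ≤ μ * (‖PowerSeries.coeff p.1 c * g.coeff p.2‖ * δ ^ n) := by gcongr
    _ = μ * (‖PowerSeries.coeff p.1 c‖ * δ ^ p.1) * (‖g.coeff p.2‖ * δ ^ p.2) := by
        rw [norm_mul, ← hpn, pow_add]; ring
    _ ≤ μ * (‖PowerSeries.coeff p.1 c‖ * δ ^ p.1) * ‖g.coeff 0‖ := by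
        gcongr; exact hg _
    _ ≤ _ := hcn _ (by omega)

/-- Reduces dominance of the constant term to linear factors. -/
theorem norm_coeff_mul_le_of_factors {p q : K[X]} {δ : ℝ} (hδ : 0 ≤ δ)
    (hp : ∀ n, ‖p.coeff n‖ * δ ^ n ≤ ‖p.coeff 0‖) (hq : ∀ n, ‖q.coeff n‖ * δ ^ n ≤ ‖q.coeff 0‖)
    (n : ℕ) : ‖(p * q).coeff n‖ * δ ^ n ≤ ‖(p * q).coeff 0‖ := by
  obtain ⟨i, hi, hle⟩ := IsUltrametricDist.exists_norm_finsetSum_le_of_nonempty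
    (show (Finset.HasAntidiagonal.antidiagonal n).Nonempty from ⟨(n, 0), by simp⟩)
    (fun i : ℕ × ℕ => p.coeff i.1 * q.coeff i.2)
  rw [← coeff_mul] at hle
  have hin : i.1 + i.2 = n := by simpa using hi
  calc ‖(p * q).coeff n‖ * δ ^ n ≤ ‖p.coeff i.1 * q.coeff i.2‖ * δ ^ n := by gcongr
    _ = (‖p.coeff i.1‖ * δ ^ i.1) * (‖q.coeff i.2‖ * δ ^ i.2) := by
        rw [norm_mul, ← hin, pow_add]; ring
    _ ≤ ‖p.coeff 0‖ * ‖q.coeff 0‖ := by gcongr <;> apply_assumption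
    _ = ‖(p * q).coeff 0‖ := by rw [mul_coeff_zero, norm_mul]

/-- The constant term of the Taylor expansion dominates on a disk without zeros. -/
theorem norm_taylor_coeff_mul_pow_le_norm_eval [IsAlgClosed K] {p : K[X]} {b : K} {δ : ℝ}
    (hδ : 0 ≤ δ) (h : ∀ y ∈ p.roots, δ ≤ ‖b - y‖) (n : ℕ) :
    ‖(taylor b p).coeff n‖ * δ ^ n ≤ ‖p.eval b‖ := by
  rw [← taylor_coeff_zero]
  have hconst : ∀ x : K, ∀ n, ‖(C x : K[X]).coeff n‖ * δ ^ n ≤ ‖(C x : K[X]).coeff 0‖ := by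
    rintro x (_ | n)
    · simp
    · simp [coeff_C]
  have hprod : ∀ s : Multiset K, (∀ y ∈ s, δ ≤ ‖b - y‖) → ∀ n,
      ‖(taylor b (s.map fun y => X - C y).prod).coeff n‖ * δ ^ n ≤
        ‖(taylor b (s.map fun y => X - C y).prod).coeff 0‖ := by
    intro s
    induction s using Multiset.induction_on with
    | empty =>
      intro _
      simpa only [Multiset.map_zero, Multiset.prod_zero, taylor_one] using hconst 1
    | cons y s ih =>
      intro hs
      rw [Multiset.map_cons, Multiset.prod_cons, taylor_mul]
      refine norm_coeff_mul_le_of_factors hδ ?_ (ih fun z hz => hs z (by simp [hz]))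
      have hy := hs y (by simp)
      rintro (_ | _ | n)
      · simp
      · simpa [coeff_X, coeff_C] using hy
      · simp [coeff_X, coeff_C]
  have hs : p.Splits := IsAlgClosed.splits p
  rw [hs.eq_prod_roots, taylor_mul, taylor_C]
  exact norm_coeff_mul_le_of_factors hδ (hconst _) (hprod _ h) n

/-- Moving the centre of a disk inside the disk does not increase the Gauss norm. -/
theorem exists_norm_taylor_coeff_mul_pow_le (p : K[X]) {b c : K} {δ : ℝ} (h : ‖c - b‖ ≤ δ)
    (n : ℕ) : ∃ m, ‖(taylor c p).coeff n‖ * δ ^ n ≤ ‖(taylor b p).coeff m‖ * δ ^ m := by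
  have hδ : 0 ≤ δ := (norm_nonneg _).trans h
  set G := taylor b p with hG
  have e : taylor c p = taylor (c - b) G := by rw [hG, taylor_taylor, sub_add_cancel]
  rw [e, taylor_coeff, hasseDeriv_apply, Polynomial.sum, eval_finsetSum]
  obtain ⟨m, -, hm⟩ := IsUltrametricDist.exists_norm_finsetSum_le G.support
    (fun i => eval (c - b) (monomial (i - n) ((i.choose n : K) * G.coeff i)))
  refine ⟨m, (mul_le_mul_of_nonneg_right hm (by positivity)).trans ?_⟩
  rw [eval_monomial, norm_mul, norm_mul, norm_pow]
  rcases Nat.lt_or_ge m n with hmn | hmn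
  · rw [Nat.choose_eq_zero_of_lt hmn]; simp; positivity
  calc ‖(m.choose n : K)‖ * ‖G.coeff m‖ * ‖c - b‖ ^ (m - n) * δ ^ n
      ≤ 1 * ‖G.coeff m‖ * δ ^ (m - n) * δ ^ n := by
        gcongr
        exact IsUltrametricDist.norm_natCast_le_one K _
    _ = ‖G.coeff m‖ * δ ^ m := by rw [mul_assoc, ← pow_add, Nat.sub_add_cancel hmn, one_mul]

end Ultrametric

/-! ### Products over roots, and the pencil `f - t g`. -/

theorem multiset_prod_map_lt {ι : Type*} {s : Multiset ι} {p q : ι → ℝ} (hp : ∀ i ∈ s, 0 < p i)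
    (hpq : ∀ i ∈ s, p i ≤ q i) {j : ι} (hj : j ∈ s) (hlt : p j < q j) :
    (s.map p).prod < (s.map q).prod := by
  obtain ⟨s, rfl⟩ := Multiset.exists_cons_of_mem hj
  simp only [Multiset.map_cons, Multiset.prod_cons]
  have h1 : (s.map p).prod ≤ (s.map q).prod :=
    Multiset.prod_map_le_prod_map₀ _ _ (fun i hi => (hp i (by simp [hi])).le)
      fun i hi => hpq i (by simp [hi])
  have h2 : 0 < (s.map p).prod := Multiset.prod_pos (by
    intro a ha
    obtain ⟨i, hi, rfl⟩ := Multiset.mem_map.1 ha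
    exact hp i (by simp [hi]))
  have h3 := hp j (by simp)
  calc p j * (s.map p).prod < q j * (s.map p).prod := by gcongr
    _ ≤ q j * (s.map q).prod := by gcongr; exact (h3.trans hlt).le

theorem natDegree_sub_C_mul {K : Type*} [Field K] {f g : K[X]} (h : g.natDegree < f.natDegree) (t : K) :
    (f - C t * g).natDegree = f.natDegree :=
  natDegree_sub_eq_left_of_natDegree_lt ((natDegree_C_mul_le _ _).trans_lt h)

theorem leadingCoeff_sub_C_mul {K : Type*} [Field K] {f g : K[X]} (h : g.natDegree < f.natDegree) (t : K) :
    (f - C t * g).leadingCoeff = f.leadingCoeff :=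
  leadingCoeff_sub_of_degree_lt
    (degree_lt_degree ((natDegree_C_mul_le _ _).trans_lt h))

theorem derivative_taylor_eq {K : Type*} [Field K] (b : K) (p : K[X]) :
    derivative (taylor b p) = taylor b (derivative p) := by
  simp [taylor_apply, derivative_comp]

/-- Subtracting a constant from `f / g` does not change its derivative, so one Wronskian serves all
fibres and all centres. -/
theorem taylor_wronskian {K : Type*} [Field K] (f g : K[X]) (b t : K) :
    derivative (taylor b (f - C t * g)) * taylor b g -
        taylor b (f - C t * g) * derivative (taylor b g) =
      taylor b (derivative f * g - f * derivative g) := by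
  rw [derivative_taylor_eq, derivative_taylor_eq, ← taylor_mul, ← taylor_mul, ← map_sub]
  refine congrArg (taylor b) ?_
  rw [derivative_sub, derivative_mul, derivative_C]
  ring

/-! ### Maximum principle along the fibres of `f / g`. -/

section MaximumPrinciple

variable {K : Type*} [NontriviallyNormedField K] [IsAlgClosed K]

/-- Reciprocity between the values of `Q` at the roots of `P` and those of `P` at the roots of `Q`,
used to compare two polynomials `P` with the same leading term. -/
theorem prod_norm_eval_roots_le {P₁ P₂ Q : K[X]} (h0 : P₁ ≠ 0)
    (hd : P₁.natDegree = P₂.natDegree) (hl : P₁.leadingCoeff = P₂.leadingCoeff)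
    (h : ∀ y ∈ Q.roots, ‖P₁.eval y‖ ≤ ‖P₂.eval y‖) :
    (P₁.roots.map fun z => ‖Q.eval z‖).prod ≤ (P₂.roots.map fun z => ‖Q.eval z‖).prod := by
  -- Both sides are the norm of the resultant of `P` and `Q`.
  have key : ∀ P : K[X], ‖P.leadingCoeff‖ ^ Q.natDegree * (P.roots.map fun z => ‖Q.eval z‖).prod =
      ‖Q.leadingCoeff‖ ^ P.natDegree * (Q.roots.map fun y => ‖P.eval y‖).prod := by
    intro P
    have e := resultant_comm P Q P.natDegree Q.natDegree
    rw [resultant_eq_prod_eval P Q _ le_rfl (IsAlgClosed.splits P),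
      resultant_eq_prod_eval Q P _ le_rfl (IsAlgClosed.splits Q)] at e
    have e' := congrArg norm e
    have hs : ∀ (s : Multiset K) (F : K[X]), ‖(s.map F.eval).prod‖ =
        (s.map fun z => ‖F.eval z‖).prod := fun s F => by
      induction s using Multiset.induction_on with
      | empty => simp
      | cons a s ih => simp [ih]
    simpa [hs] using e'
  have hl0 : 0 < ‖P₁.leadingCoeff‖ ^ Q.natDegree := by
    have : 0 < ‖P₁.leadingCoeff‖ := norm_pos_iff.2 (leadingCoeff_ne_zero.2 h0)
    positivity
  refine le_of_mul_le_mul_left ?_ hl0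
  rw [key P₁, hl, key P₂, hd]
  gcongr
  exact Multiset.prod_map_le_prod_map₀ _ _ (fun _ _ => norm_nonneg _) h

variable [IsUltrametricDist K]

/-- Maximum principle: if `u / v` has no poles over the closed disk of radius `ρ` with respect to
the map `f / g`, then a bound for `u / v` over the generic points of slightly larger circles
holds over the centre of the disk. -/
theorem norm_eval_le_of_eventually {f g u v : K[X]} (hfg : g.natDegree < f.natDegree) {z₀ : K}
    (hz₀ : f.eval z₀ = 0) {ρ M : ℝ} (hρ : 0 ≤ ρ) (hM : 0 ≤ M) (hv : v ≠ 0)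
    (hvr : ∀ y, v.eval y = 0 → ρ * ‖g.eval y‖ < ‖f.eval y‖)
    (h : ∀ᶠ x in 𝓝[>] ρ, ∀ t : K, ‖t‖ = x → ∀ b, f.eval b = t * g.eval b →
      ‖u.eval b‖ ≤ M * ‖v.eval b‖) :
    ‖u.eval z₀‖ ≤ M * ‖v.eval z₀‖ := by
  classical
  by_contra! hlt
  have hf0 : f ≠ 0 := by rintro rfl; simp at hfg
  have hroot : ∀ z, f.eval z = 0 → v.eval z ≠ 0 := fun z hz hvz => by
    have := hvr z hvz
    rw [hz, norm_zero] at this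
    exact absurd this (not_lt.2 (by positivity))
  have hvz0 := norm_pos_iff.2 (hroot z₀ hz₀)
  -- With `‖x₀‖` generic just above `M`, nothing cancels in `Q = x₀ v - u` at the zeros of `f`, so
  -- `‖Q‖` is there the larger of the two norms.
  obtain ⟨x₀, hx₀M, hx₀lt, hx₀⟩ := exists_norm_of_eventually_nhdsGT (K := K) hM
    (p := fun x => x * ‖v.eval z₀‖ < ‖u.eval z₀‖ ∧
      ∀ z ∈ f.roots.toFinset, x * ‖v.eval z‖ ≠ ‖u.eval z‖)
    ((eventually_nhdsGT_mul_lt hlt).and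
      ((Finset.eventually_all _).2 fun z hz => eventually_nhdsGT_mul_ne _
        (norm_ne_zero_iff.2 (hroot z (by simpa [hf0] using hz)))))
  set Q : K[X] := C x₀ * v - u with hQ
  have hQe : ∀ z, Q.eval z = x₀ * v.eval z - u.eval z := fun z => by simp [hQ]
  -- `‖t‖` is so close to `ρ` that `f` dominates `t g` at the zeros of `v`, and generic so that `f`
  -- and `t g` do not cancel at those of `Q`.
  obtain ⟨t, -, ht, htv, htQ⟩ := exists_norm_of_eventually_nhdsGT (K := K) hρ
    (p := fun x => (∀ t : K, ‖t‖ = x → ∀ b, f.eval b = t * g.eval b →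
      ‖u.eval b‖ ≤ M * ‖v.eval b‖) ∧
      (∀ y ∈ v.roots.toFinset, x * ‖g.eval y‖ < ‖f.eval y‖) ∧
      ∀ y ∈ Q.roots.toFinset, g.eval y ≠ 0 → x * ‖g.eval y‖ ≠ ‖f.eval y‖)
    (h.and (((Finset.eventually_all _).2 fun y hy => eventually_nhdsGT_mul_lt
        (hvr y (by simpa [hv] using hy))).and
      ((Finset.eventually_all _).2 fun y _ => by
        by_cases hg : g.eval y = 0
        · simp [hg]
        · filter_upwards [eventually_nhdsGT_mul_ne ρ (norm_ne_zero_iff.2 hg)] with x hx _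
          exact hx)))
  replace ht := ht t rfl
  set P := f - C t * g with hP
  have hPe : ∀ z, P.eval z = f.eval z - t * g.eval z := fun z => by simp [hP]
  have hPd := natDegree_sub_C_mul hfg t
  have hPl := leadingCoeff_sub_C_mul hfg t
  have hP0 : P ≠ 0 := by
    intro h
    rw [← hP, h] at hPd
    simp at hPd; omega
  have hvP : ∀ y ∈ v.roots, ‖P.eval y‖ = ‖f.eval y‖ := fun y hy => by
    have := htv y (by simpa using hy)
    rw [← norm_mul] at this
    rw [hPe, norm_sub_eq_max_of_ne this.ne', max_eq_left this.le]
  have hQP : ∀ y ∈ Q.roots, ‖f.eval y‖ ≤ ‖P.eval y‖ := fun y hy => by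
    by_cases hg : g.eval y = 0
    · rw [hPe, hg]; simp
    · have := htQ y (by simpa using hy) hg
      rw [← norm_mul] at this
      rw [hPe, norm_sub_eq_max_of_ne this.symm]
      exact le_max_left _ _
  have hN1 := prod_norm_eval_roots_le hf0 hPd.symm hPl.symm hQP
  have hN2 := prod_norm_eval_roots_le hP0 hPd hPl fun y hy => (hvP y hy).le
  have hx₀pos : 0 < ‖x₀‖ := hM.trans_lt hx₀M
  -- The contradiction is the cycle `∏_f |x₀ v| < ∏_f |Q| ≤ ∏_P |Q| ≤ ∏_P |x₀ v| ≤ ∏_f |x₀ v|`, with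
  -- products over the roots of `f` or `P`; the strict inequality comes from `z₀`.
  have hA : (f.roots.map fun z => ‖x₀‖ * ‖v.eval z‖).prod <
      (f.roots.map fun z => ‖Q.eval z‖).prod := by
    have hQz : ∀ z ∈ f.roots, ‖Q.eval z‖ = max (‖x₀‖ * ‖v.eval z‖) ‖u.eval z‖ := fun z hz => by
      have := hx₀ z (by simpa using hz)
      rw [← norm_mul] at this ⊢
      rw [hQe, norm_sub_eq_max_of_ne this]
    have hz₀' : z₀ ∈ f.roots := by simpa [hf0] using hz₀
    refine multiset_prod_map_lt (fun z hz => ?_) (fun z hz => ?_) hz₀' ?_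
    · have := norm_pos_iff.2 (hroot z (by simpa [hf0] using hz))
      positivity
    · rw [hQz z hz]; exact le_max_left _ _
    · rw [hQz z₀ hz₀']; exact hx₀lt.trans_le (le_max_right _ _)
  have hB : (P.roots.map fun z => ‖Q.eval z‖).prod ≤
      (P.roots.map fun z => ‖x₀‖ * ‖v.eval z‖).prod := by
    refine Multiset.prod_map_le_prod_map₀ _ _ (fun _ _ => norm_nonneg _) fun z hz => ?_
    have hz' : P.eval z = 0 := by simpa [hP0] using hz
    have := ht z (by rw [hPe] at hz'; linear_combination hz')
    rw [hQe]
    refine (norm_sub_le_max_norm _ _).trans (max_le (norm_mul _ _).le (this.trans ?_))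
    gcongr
  rw [Multiset.prod_map_mul, Multiset.map_const', Multiset.prod_replicate] at hA hB
  have hcard : Multiset.card P.roots = Multiset.card f.roots := by
    rw [← (IsAlgClosed.splits P).natDegree_eq_card_roots,
      ← (IsAlgClosed.splits f).natDegree_eq_card_roots, hPd]
  rw [hcard] at hB
  have := mul_le_mul_of_nonneg_left hN2 (show 0 ≤ ‖x₀‖ ^ Multiset.card f.roots by positivity)
  linarith

end MaximumPrinciple

/-! ### Local behaviour over a generic point of a circle. -/

section Generic

variable {K : Type*} [NontriviallyNormedField K] [IsUltrametricDist K]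

/-- At a generic point `t` of a circle, no disk centred in `S` is mapped by `f / g` into the open
disk of radius `‖t‖` about `t`. -/
theorem eventually_le_norm_taylor_coeff_sub (f g : K[X]) (S : Finset K) (ρ : ℝ) :
    ∀ᶠ x in 𝓝[>] ρ, ∀ t : K, ‖t‖ = x → ∀ c ∈ S, ∀ n,
      ‖t‖ * ‖(taylor c g).coeff n‖ ≤ ‖(taylor c (f - C t * g)).coeff n‖ := by
  have h : ∀ᶠ x in 𝓝[>] ρ, ∀ c ∈ S, ∀ n ∈ Finset.range (g.natDegree + 1),
      (taylor c g).coeff n ≠ 0 → x * ‖(taylor c g).coeff n‖ ≠ ‖(taylor c f).coeff n‖ := by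
    refine (Finset.eventually_all _).2 fun c _ => (Finset.eventually_all _).2 fun n _ => ?_
    by_cases hg : (taylor c g).coeff n = 0
    · simp [hg]
    · filter_upwards [eventually_nhdsGT_mul_ne ρ (norm_ne_zero_iff.2 hg)] with x hx _
      exact hx
  filter_upwards [h] with x hx t ht c hc n
  by_cases hg : (taylor c g).coeff n = 0
  · simp [hg]
  have hn : n ∈ Finset.range (g.natDegree + 1) := by
    rw [Finset.mem_range, Nat.lt_succ_iff, ← natDegree_taylor g c]
    exact le_natDegree_of_ne_zero hg
  have hne := hx c hc n hn hg
  have e : (taylor c (f - C t * g)).coeff n =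
      (taylor c f).coeff n - t * (taylor c g).coeff n := by
    rw [map_sub, taylor_mul, taylor_C, coeff_sub, coeff_C_mul]
  rw [← ht, ← norm_mul] at hne
  rw [e, norm_sub_eq_max_of_ne hne.symm, norm_mul]
  exact le_max_right _ _

/-- Local description of `f / g` near a preimage `b` of a generic point `t`: on some disk around
`b` which avoids `S`, the map takes values in the closed disk of radius `‖t‖` about `t`, and its
derivative at `b` is not much smaller than the quotient of the two radii. -/
theorem exists_radius_of_generic [IsAlgClosed K] {f g : K[X]} (hfg : g.natDegree < f.natDegree) {μ : ℝ}
    (hμ : 0 ≤ μ) (hμd : ∀ n : ℕ, 1 ≤ n → n ≤ f.natDegree → μ ≤ ‖(n : K)‖)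
    {S : Finset K} (hS : S.Nonempty) (hSg : ∀ y, g.eval y = 0 → y ∈ S)
    (hSA : ∀ y, (derivative f * g - f * derivative g).eval y = 0 → y ∈ S)
    {t b : K} (ht : t ≠ 0) (hb : f.eval b = t * g.eval b) (hbS : b ∉ S)
    (hgen : ∀ c ∈ S, ∀ n,
      ‖t‖ * ‖(taylor c g).coeff n‖ ≤ ‖(taylor c (f - C t * g)).coeff n‖) :
    ∃ δ > 0, (∀ y ∈ S, δ ≤ ‖b - y‖) ∧
      (∀ n, ‖(taylor b (f - C t * g)).coeff n‖ * δ ^ n ≤ ‖t‖ * ‖g.eval b‖) ∧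
      μ * (‖t‖ * ‖g.eval b‖) ≤ ‖(taylor b (f - C t * g)).coeff 1‖ * δ := by
  set F := f - C t * g with hF
  set G := taylor b F with hG
  have hgb : g.eval b ≠ 0 := fun h => hbS (hSg b h)
  have hG0 : G.coeff 0 = 0 := by rw [hG, taylor_coeff_zero, hF]; simp [hb]
  have hGd : G.natDegree = f.natDegree := by rw [hG, natDegree_taylor, natDegree_sub_C_mul hfg]
  have htg : 0 < ‖t‖ * ‖g.eval b‖ := mul_pos (norm_pos_iff.2 ht) (norm_pos_iff.2 hgb)
  obtain ⟨c, hcS, hc⟩ := S.exists_min_image (fun y => ‖b - y‖) hS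
  -- On the disk reaching the nearest point `c` of `S`, the Gauss norm of `F` is already large:
  -- recentre at `c`, where genericity applies, and return to `b`.
  obtain ⟨n₀, hn₀⟩ : ∃ n, ‖t‖ * ‖g.eval b‖ ≤ ‖G.coeff n‖ * ‖b - c‖ ^ n := by
    obtain ⟨m, hm⟩ := exists_norm_taylor_coeff_mul_pow_le g (le_refl ‖b - c‖) 0
    obtain ⟨n, hn⟩ := exists_norm_taylor_coeff_mul_pow_le F (norm_sub_rev c b).le m
    refine ⟨n, le_trans ?_ hn⟩
    rw [taylor_coeff_zero, pow_zero, mul_one] at hm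
    calc ‖t‖ * ‖g.eval b‖ ≤ ‖t‖ * (‖(taylor c g).coeff m‖ * ‖b - c‖ ^ m) := by gcongr
      _ = ‖t‖ * ‖(taylor c g).coeff m‖ * ‖b - c‖ ^ m := by ring
      _ ≤ _ := by gcongr; exact hgen c hcS m
  have hn₀d : n₀ ∈ Finset.range (f.natDegree + 1) := by
    rw [Finset.mem_range, Nat.lt_succ_iff, ← hGd]
    refine le_natDegree_of_ne_zero fun h => ?_
    rw [h, norm_zero, zero_mul] at hn₀
    linarith
  have hne : (Finset.range (f.natDegree + 1)).Nonempty := ⟨n₀, hn₀d⟩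
  -- The Gauss norm is continuous in the radius and vanishes at `0`; the intermediate value theorem
  -- yields the radius `δ` where it equals `‖t‖ * ‖g.eval b‖`.
  set N : ℝ → ℝ := fun x =>
    (Finset.range (f.natDegree + 1)).sup' hne fun n => ‖G.coeff n‖ * x ^ n with hN
  have hNc : Continuous N := Continuous.finset_sup'_apply hne fun n _ => by fun_prop
  have hN0 : N 0 ≤ ‖t‖ * ‖g.eval b‖ := by
    refine Finset.sup'_le _ _ fun n _ => ?_
    rcases n with _ | n
    · simp [hG0, htg.le]
    · simp [htg.le]
  have hN1 : ‖t‖ * ‖g.eval b‖ ≤ N ‖b - c‖ :=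
    hn₀.trans (Finset.le_sup' (fun n => ‖G.coeff n‖ * ‖b - c‖ ^ n) hn₀d)
  obtain ⟨δ, ⟨hδ0, hδ1⟩, hδ⟩ := intermediate_value_Icc (norm_nonneg (b - c)) hNc.continuousOn
    ⟨hN0, hN1⟩
  have hle : ∀ n, ‖G.coeff n‖ * δ ^ n ≤ ‖t‖ * ‖g.eval b‖ := fun n => by
    by_cases hn : n ∈ Finset.range (f.natDegree + 1)
    · rw [← hδ]
      exact Finset.le_sup' (fun n => ‖G.coeff n‖ * δ ^ n) hn
    · rw [coeff_eq_zero_of_natDegree_lt (by rw [hGd]; simpa using hn)]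
      simp [htg.le]
  obtain ⟨m, -, hm⟩ := Finset.exists_mem_eq_sup' hne fun n => ‖G.coeff n‖ * δ ^ n
  have hm' : ‖t‖ * ‖g.eval b‖ = ‖G.coeff m‖ * δ ^ m := by rw [← hδ, ← hm]
  have hδpos : 0 < δ := by
    refine lt_of_le_of_ne hδ0 fun h => htg.ne' ?_
    rw [hm', ← h]
    rcases m with _ | m
    · simp [hG0]
    · simp
  have hSδ : ∀ y ∈ S, δ ≤ ‖b - y‖ := fun y hy => hδ1.trans (hc y hy)
  refine ⟨δ, hδpos, hSδ, hle, ?_⟩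
  rw [hm']
  have hA := taylor_wronskian f g b t
  have hg0 : (taylor b g).coeff 0 = g.eval b := taylor_coeff_zero _ _
  refine mul_norm_coeff_le_norm_coeff_one (F := G) (g := taylor b g) hδpos hμ hμd hG0 hGd.le
    (by rwa [hg0]) (fun n => ?_) (fun n => ?_) m
  · rw [hg0]
    exact norm_taylor_coeff_mul_pow_le_norm_eval hδ0
      (fun y hy => hSδ y (hSg y (isRoot_of_mem_roots hy))) n
  · rw [hA, taylor_coeff_zero b (derivative f * g - f * derivative g)]
    exact norm_taylor_coeff_mul_pow_le_norm_eval hδ0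
      (fun y hy => hSδ y (hSA y (isRoot_of_mem_roots hy))) n

end Generic

/-! ### Distance from `a` to the other zeros and the poles. -/

section Distance

variable {K : Type*} [NontriviallyNormedField K] [IsUltrametricDist K]

/-- If a polynomial vanishing at `a` has another zero at `c`, then one of its higher Taylor
coefficients at `a` is at least as large as the linear one on the disk of radius `‖c - a‖`. -/
theorem exists_norm_taylor_coeff_one_le {f : K[X]} {a c : K} (ha : f.eval a = 0)
    (hc : f.eval c = 0) (hca : c ≠ a) :
    ∃ j, 1 ≤ j ∧ ‖(taylor a f).coeff 1‖ ≤ ‖(taylor a f).coeff (j + 1)‖ * ‖c - a‖ ^ j := by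
  set G := taylor a f with hG
  have hR : 0 < ‖c - a‖ := norm_pos_iff.2 (sub_ne_zero.2 hca)
  have h0 : G.coeff 0 = 0 := by rw [hG, taylor_coeff_zero, ha]
  have hsum : ∑ i ∈ Finset.range (G.natDegree + 2), G.coeff (i + 1) * (c - a) ^ (i + 1) = 0 := by
    have : G.eval (c - a) = 0 := by rw [hG, taylor_eval, sub_add_cancel, hc]
    rw [eval_eq_sum_range' (n := G.natDegree + 3) (by omega), Finset.sum_range_succ', h0] at this
    simpa using this
  rw [Finset.sum_range_succ', add_eq_zero_iff_eq_neg] at hsum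
  obtain ⟨i, -, hi⟩ := IsUltrametricDist.exists_norm_finsetSum_le_of_nonempty
    (show (Finset.range (G.natDegree + 1)).Nonempty from ⟨0, by simp⟩)
    (fun i => G.coeff (i + 1 + 1) * (c - a) ^ (i + 1 + 1))
  rw [hsum, norm_neg] at hi
  refine ⟨i + 1, by omega, le_of_mul_le_mul_right ?_ hR⟩
  simpa [norm_mul, norm_pow, pow_succ, mul_assoc] using hi

variable [IsAlgClosed K]

/-- If all finite critical values of `f / g` lie outside the closed disk of radius `ρ` about
`0 = f(a) / g(a)`, then the other zeros and the poles of `f / g` keep away from `a`. -/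
theorem sq_mul_le_norm_sub_mul {f g : K[X]} (hfg : g.natDegree < f.natDegree)
    (hcop : IsCoprime f g) {μ : ℝ} (hμ : 0 < μ) (hμ1 : μ ≤ 1)
    (hμd : ∀ n : ℕ, 1 ≤ n → n ≤ f.natDegree → μ ≤ ‖(n : K)‖)
    {a c : K} (ha : f.eval a = 0) (hda : (derivative f).eval a ≠ 0)
    (hca : c ≠ a) (hc : f.eval c = 0 ∨ g.eval c = 0) {ρ : ℝ} (hρ : 0 < ρ)
    (hcrit : ∀ y, g.eval y ≠ 0 → (derivative f * g - f * derivative g).eval y = 0 →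
      ρ * ‖g.eval y‖ < ‖f.eval y‖) :
    μ ^ 2 * (ρ * ‖g.eval a‖) ≤ ‖c - a‖ * ‖(derivative f).eval a‖ := by
  classical
  set A := derivative f * g - f * derivative g with hA
  have hnz : ∀ y, g.eval y = 0 → f.eval y ≠ 0 := fun y hy hy' => by
    obtain ⟨p, q, hpq⟩ := hcop
    have := congrArg (eval y) hpq
    simp [hy, hy'] at this
  have hga : g.eval a ≠ 0 := fun h => hnz a h ha
  have hAa : A.eval a = (derivative f).eval a * g.eval a := by simp [hA, ha]
  have hAa0 : A.eval a ≠ 0 := by rw [hAa]; exact mul_ne_zero hda hga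
  have hA0 : A ≠ 0 := by rintro h; simp [h] at hAa0
  have hg0 : g ≠ 0 := by rintro h; simp [h] at hga
  have hpole : ∀ y, g.eval y = 0 → ρ * ‖g.eval y‖ < ‖f.eval y‖ := fun y hy => by
    rw [hy, norm_zero, mul_zero]; exact norm_pos_iff.2 (hnz y hy)
  have hAr : ∀ y, A.eval y = 0 → ρ * ‖g.eval y‖ < ‖f.eval y‖ := fun y hy => by
    by_cases hgy : g.eval y = 0
    · exact hpole y hgy
    · exact hcrit y hgy hy
  set S : Finset K := insert a (A.roots.toFinset ∪ g.roots.toFinset) with hS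
  have hSg : ∀ y, g.eval y = 0 → y ∈ S := fun y hy => by simp [hS, hg0, hy]
  have hSA : ∀ y, A.eval y = 0 → y ∈ S := fun y hy => by simp [hS, hA0, hy]
  have hloc : ∀ᶠ x in 𝓝[>] ρ, ∀ t : K, ‖t‖ = x → ∀ b, f.eval b = t * g.eval b →
      ρ < ‖t‖ ∧ g.eval b ≠ 0 ∧ ∃ δ > 0, (∀ y ∈ S, δ ≤ ‖b - y‖) ∧
        (∀ n, ‖(taylor b (f - C t * g)).coeff n‖ * δ ^ n ≤ ‖t‖ * ‖g.eval b‖) ∧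
        μ * (‖t‖ * ‖g.eval b‖) ≤ ‖(taylor b (f - C t * g)).coeff 1‖ * δ := by
    filter_upwards [eventually_le_norm_taylor_coeff_sub f g S ρ, self_mem_nhdsWithin,
      (Finset.eventually_all A.roots.toFinset).2 fun y hy => eventually_nhdsGT_mul_lt
        (hAr y (by simpa [hA0] using hy))] with x hx hρx hxA t ht b hb
    rw [← ht] at hρx hxA
    have ht0 : t ≠ 0 := norm_pos_iff.1 (hρ.trans hρx)
    have hgb : g.eval b ≠ 0 := fun h => hnz b h (by rw [hb, h, mul_zero])
    refine ⟨hρx, hgb, exists_radius_of_generic hfg hμ.le hμd ⟨a, by simp [hS]⟩ hSg hSA ht0 hb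
      ?_ (hx t ht)⟩
    simp only [hS, Finset.mem_insert, Finset.mem_union, not_or]
    refine ⟨?_, fun h => ?_, fun h => hgb (isRoot_of_mem_roots (by simpa using h))⟩
    · rintro rfl
      rw [ha] at hb
      exact mul_ne_zero ht0 hgb hb.symm
    · have := hxA b h
      rw [hb, norm_mul] at this
      exact lt_irrefl _ this
  have hFA : ∀ t b : K, f.eval b = t * g.eval b →
      A.eval b = (taylor b (f - C t * g)).coeff 1 * g.eval b := fun t b hb => by
    rw [taylor_coeff_one, hA]
    simp [hb]
    ring
  have hga' := norm_pos_iff.2 hga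
  have hda' := norm_pos_iff.2 hda
  rcases hc with hc | hc
  · obtain ⟨j, hj, hjle⟩ := exists_norm_taylor_coeff_one_le ha hc hca
    -- On the fibre over `t`, `A` and `B` are `g` times the Taylor coefficients of `f - t g` of
    -- orders `1` and `j + 1`. The power of `g` in `u` makes `u / v` equal to `F_{j+1} g^j /
    -- F_1^{j+1}`, so the powers of `δ` cancel in its bound.
    set B := hasseDeriv (j + 1) f * g - f * hasseDeriv (j + 1) g with hB
    have hFB : ∀ t b : K, f.eval b = t * g.eval b →
        B.eval b = (taylor b (f - C t * g)).coeff (j + 1) * g.eval b := fun t b hb => by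
      rw [hB, map_sub, taylor_mul, taylor_C, coeff_sub, coeff_C_mul, taylor_coeff, taylor_coeff]
      simp [hb]
      ring
    have key := norm_eval_le_of_eventually (u := B * g ^ (2 * j)) (v := A ^ (j + 1)) hfg ha hρ.le
      (M := (μ ^ (j + 1) * ρ ^ j)⁻¹) (by positivity) (pow_ne_zero _ hA0)
      (fun y hy => hAr y (by simpa using hy)) (by
        filter_upwards [hloc] with x hx t ht b hb
        obtain ⟨hρt, hgb, δ, hδ, -, hle, hge⟩ := hx t ht b hb
        have hgb' := norm_pos_iff.2 hgb
        have h1 := hle (j + 1)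
        have h2 := pow_le_pow_left₀ (by positivity) hge (j + 1)
        rw [inv_mul_eq_div, le_div_iff₀ (by positivity), eval_mul, eval_pow, eval_pow,
          hFA t b hb, hFB t b hb]
        simp only [norm_mul, norm_pow]
        set x1 := ‖(taylor b (f - C t * g)).coeff 1‖
        set xj := ‖(taylor b (f - C t * g)).coeff (j + 1)‖
        set G := ‖g.eval b‖
        refine le_of_mul_le_mul_right ?_ (show 0 < δ ^ (j + 1) by positivity)
        calc xj * G * G ^ (2 * j) * (μ ^ (j + 1) * ρ ^ j) * δ ^ (j + 1)
            = (xj * δ ^ (j + 1)) * (G * G ^ (2 * j) * (μ ^ (j + 1) * ρ ^ j)) := by ring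
          _ ≤ (‖t‖ * G) * (G * G ^ (2 * j) * (μ ^ (j + 1) * ‖t‖ ^ j)) := by gcongr
          _ = (μ * (‖t‖ * G)) ^ (j + 1) * G ^ (j + 1) := by ring
          _ ≤ (x1 * δ) ^ (j + 1) * G ^ (j + 1) := by gcongr
          _ = (x1 * G) ^ (j + 1) * δ ^ (j + 1) := by ring)
    have hBa : B.eval a = (taylor a f).coeff (j + 1) * g.eval a := by
      simpa using hFB 0 a (by simp [ha])
    rw [taylor_coeff_one] at hjle
    rw [inv_mul_eq_div, le_div_iff₀ (by positivity), eval_mul, eval_pow, eval_pow, hAa, hBa] at key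
    simp only [norm_mul, norm_pow] at key
    set x1 := ‖(derivative f).eval a‖
    set xj := ‖(taylor a f).coeff (j + 1)‖
    set G := ‖g.eval a‖
    set R := ‖c - a‖
    refine le_of_pow_le_pow_left₀ (n := j) (by omega) (by positivity) ?_
    refine le_of_mul_le_mul_right ?_ (show 0 < x1 * G ^ (j + 1) by positivity)
    calc (μ ^ 2 * (ρ * G)) ^ j * (x1 * G ^ (j + 1))
        = μ ^ (2 * j) * (ρ ^ j * G ^ (2 * j + 1) * x1) := by ring
      _ ≤ μ ^ (j + 1) * (ρ ^ j * G ^ (2 * j + 1) * (xj * R ^ j)) := by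
          gcongr ?_ * (_ * ?_)
          -- `j + 1 ≤ 2 j` because `j ≥ 1`; this is where the exponent `2` of `μ` comes from.
          exact pow_le_pow_of_le_one hμ.le hμ1 (by omega)
      _ = (xj * G * G ^ (2 * j) * (μ ^ (j + 1) * ρ ^ j)) * R ^ j := by ring
      _ ≤ (x1 * G) ^ (j + 1) * R ^ j := by gcongr
      _ = (R * x1) ^ j * (x1 * G ^ (j + 1)) := by ring
  -- Here `u / v = 1 / ((z - c) ψ')`; at a point `b` over `t` it is controlled by `|b - c| ≥ δ`, as
  -- the pole `c` lies in `S`.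
  · have key := norm_eval_le_of_eventually (u := g ^ 2) (v := (X - C c) * A) hfg ha hρ.le
      (M := (μ * ρ)⁻¹) (by positivity) (mul_ne_zero (X_sub_C_ne_zero c) hA0)
      (fun y hy => by
        rw [eval_mul, mul_eq_zero] at hy
        rcases hy with hy | hy
        · have : y = c := by simpa [sub_eq_zero] using hy
          exact hpole y (this ▸ hc)
        · exact hAr y hy) (by
        filter_upwards [hloc] with x hx t ht b hb
        obtain ⟨hρt, hgb, δ, hδ, hδS, -, hge⟩ := hx t ht b hb
        have hbc := hδS c (hSg c hc)
        rw [inv_mul_eq_div, le_div_iff₀ (by positivity), eval_mul, eval_pow, hFA t b hb]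
        simp only [norm_mul, norm_pow, eval_sub, eval_X, eval_C]
        set x1 := ‖(taylor b (f - C t * g)).coeff 1‖
        set G := ‖g.eval b‖
        calc G ^ 2 * (μ * ρ) ≤ G ^ 2 * (μ * ‖t‖) := by gcongr
          _ = (μ * (‖t‖ * G)) * G := by ring
          _ ≤ (x1 * δ) * G := by gcongr
          _ ≤ (x1 * ‖b - c‖) * G := by gcongr
          _ = ‖b - c‖ * (x1 * G) := by ring)
    rw [inv_mul_eq_div, le_div_iff₀ (by positivity), eval_mul, eval_pow, hAa] at key
    simp only [norm_mul, norm_pow, eval_sub, eval_X, eval_C] at key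
    rw [norm_sub_rev] at key
    set x1 := ‖(derivative f).eval a‖
    set G := ‖g.eval a‖
    refine le_of_mul_le_mul_right ?_ hga'
    calc μ ^ 2 * (ρ * G) * G = μ * (G ^ 2 * (μ * ρ)) := by ring
      _ ≤ 1 * (G ^ 2 * (μ * ρ)) := by gcongr
      _ ≤ _ := by rw [one_mul]; exact key.trans_eq (by ring)

end Distance

/-! ### Translation from rational functions to polynomials, and the constant `ε`. -/

section Values

theorem value_eq {K : Type*} [Field K] (φ : RatFunc K) (z : K) :
    value φ z = φ.num.eval z / φ.denom.eval z := by
  simp [value, RatFunc.eval]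

theorem toMap_coe_ne_infty_iff {K : Type*} [Field K] (φ : RatFunc K) (z : K) :
    toMap φ z ≠ OnePoint.infty ↔ φ.denom.eval z ≠ 0 := by
  classical
  change (if φ.denom.eval z = 0 then OnePoint.infty else ((value φ z : K) : OnePoint K)) ≠ _ ↔ _
  split_ifs with h <;> simp [h]

theorem toMap_coe_of_ne_zero {K : Type*} [Field K] {φ : RatFunc K} {z : K}
    (h : φ.denom.eval z ≠ 0) : toMap φ z = ((value φ z : K) : OnePoint K) := by
  classical
  change (if φ.denom.eval z = 0 then OnePoint.infty else ((value φ z : K) : OnePoint K)) = _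
  rw [if_neg h]

theorem natDegree_denom_lt_of_toMap_infty {K : Type*} [Field K] {φ : RatFunc K}
    (h : toMap φ OnePoint.infty = OnePoint.infty) : φ.denom.natDegree < φ.num.natDegree := by
  change (if φ.denom.natDegree < φ.num.natDegree then OnePoint.infty
      else ((φ.num.coeff φ.denom.natDegree / φ.denom.leadingCoeff : K) : OnePoint K)) = _ at h
  by_contra hlt
  rw [if_neg hlt] at h
  exact OnePoint.coe_ne_infty _ h

theorem deriv_value {K : Type*} [NontriviallyNormedField K] {φ : RatFunc K} {z : K}
    (h : φ.denom.eval z ≠ 0) :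
    deriv (value φ) z = (derivative φ.num * φ.denom - φ.num * derivative φ.denom).eval z /
      φ.denom.eval z ^ 2 := by
  have e : value φ = fun z => φ.num.eval z / φ.denom.eval z := funext (value_eq φ)
  rw [e, HasDerivAt.deriv (HasDerivAt.fun_div (φ.num.hasDerivAt z) (φ.denom.hasDerivAt z) h)]
  simp

theorem exists_epsilon_eq {K : Type*} [NontriviallyNormedField K] [IsUltrametricDist K] {d : ℕ}
    (hd : 2 ≤ d) (hchar : ringChar K = 0 ∨ d < ringChar K) :
    ∃ μ : ℝ, 0 < μ ∧ μ ≤ 1 ∧ (∀ n : ℕ, 1 ≤ n → n ≤ d → μ ≤ ‖(n : K)‖) ∧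
      epsilon K d hd = μ ^ d := by
  obtain ⟨m, hm, he⟩ := Finset.exists_mem_eq_inf' (Finset.nonempty_Icc.mpr (by omega : 1 ≤ d))
    fun m : ℕ => ‖(m : K)‖ ^ d
  rw [Finset.mem_Icc] at hm
  refine ⟨‖(m : K)‖, norm_pos_iff.2 fun h => ?_, IsUltrametricDist.norm_natCast_le_one K m,
    fun n h1 h2 => ?_, he⟩
  · have hdvd := (ringChar.spec K m).1 h
    rcases hchar with h0 | h0
    · rw [h0, zero_dvd_iff] at hdvd; omega
    · have := Nat.le_of_dvd (by omega) hdvd; omega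
  · refine le_of_pow_le_pow_left₀ (n := d) (by omega) (norm_nonneg _) ?_
    rw [← he]
    exact Finset.inf'_le (fun m : ℕ => ‖(m : K)‖ ^ d) (Finset.mem_Icc.2 ⟨h1, h2⟩)

end Values

/-! ### The radius `r` as a distance to a zero or pole. -/

section Radius

variable {K : Type*} [NontriviallyNormedField K]

/-- The zeros and poles of `φ - φ(a)` other than `a` nearest to `a` lie at distance at most the
radius `r`. -/
theorem exists_enorm_sub_le_of_isGreatest {φ : RatFunc K} {a : K} (ha : φ.denom.eval a ≠ 0)
    {r : ℝ≥0∞} (hr : IsGreatest {ρ : ℝ≥0∞ | Disjoint (puncturedDisk a ρ)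
      (toMap φ ⁻¹' {toMap φ a, OnePoint.infty})} r)
    {f : K[X]} (hf : f = φ.num - C (value φ a) * φ.denom) (hf0 : f ≠ 0)
    (hex : ∃ c, c ≠ a ∧ f.eval c = 0) :
    ∃ c, c ≠ a ∧ (f.eval c = 0 ∨ φ.denom.eval c = 0) ∧ ‖c - a‖ₑ ≤ r := by
  classical
  set T : Finset K := (f.roots.toFinset ∪ φ.denom.roots.toFinset).erase a with hT
  have hmem : ∀ c, c ∈ T ↔ c ≠ a ∧ (f.eval c = 0 ∨ φ.denom.eval c = 0) := fun c => by
    simp [hT, hf0, φ.denom_ne_zero]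
  obtain ⟨c, hca, hfc⟩ := hex
  obtain ⟨c, hcT, hmin⟩ := T.exists_min_image (fun c => edist c a) ⟨c, (hmem c).2 ⟨hca, .inl hfc⟩⟩
  refine ⟨c, ((hmem c).1 hcT).1, ((hmem c).1 hcT).2, ?_⟩
  rw [← edist_eq_enorm_sub]
  refine hr.2 (Set.disjoint_left.2 ?_)
  rintro _ ⟨z, ⟨hz, hza⟩, rfl⟩ hzm
  have hzT : z ∈ T := by
    rw [hmem]
    refine ⟨hza, ?_⟩
    by_cases hd : φ.denom.eval z = 0
    · exact .inr hd
    left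
    rcases hzm with h | h
    · rw [toMap_coe_of_ne_zero ha] at h
      rw [toMap_coe_of_ne_zero hd, OnePoint.coe_eq_coe] at h
      rw [hf, eval_sub, eval_mul, eval_C, ← h, value_eq]
      field_simp
      ring
    · exact absurd h ((toMap_coe_ne_infty_iff φ z).2 hd)
  exact absurd (Metric.mem_eball.1 hz) (not_lt.2 (hmin z hzT))

end Radius

end RationalMap

/-! ### The main theorem. -/

theorem mainTheorem6 {K : Type*} [NontriviallyNormedField K] [IsUltrametricDist K]
    [CompleteSpace K] [IsAlgClosed K]
    (d : ℕ) (hd : 2 ≤ d) (hchar : ringChar K = 0 ∨ d < ringChar K)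
    (φ : RatFunc K) (hφ : RationalMap.degree φ = d)
    (hinf : RationalMap.toMap φ OnePoint.infty = OnePoint.infty)
    (a : K) (ha : RationalMap.toMap φ a ≠ OnePoint.infty)
    (r : ℝ≥0∞)
    (hr : IsGreatest
      {ρ : ℝ≥0∞ | Disjoint (RationalMap.puncturedDisk a ρ)
        (RationalMap.toMap φ ⁻¹' {RationalMap.toMap φ a, OnePoint.infty})} r) :
    ∃ β : K, RationalMap.toMap φ β ≠ OnePoint.infty ∧ deriv (RationalMap.value φ) β = 0 ∧
      ‖RationalMap.value φ β - RationalMap.value φ a‖ₑ ≤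
        (ENNReal.ofReal (RationalMap.epsilon K d hd))⁻¹ * r *
          ‖deriv (RationalMap.value φ) a‖ₑ := by
  classical
  open RationalMap Polynomial Filter Topology in
  by_contra! hcon
  have hga := (toMap_coe_ne_infty_iff φ a).1 ha
  -- Otherwise `β = a` works.
  have hda : deriv (value φ) a ≠ 0 := fun h => by
    have := hcon a ha h
    simp at this
  have hdeg := natDegree_denom_lt_of_toMap_infty hinf
  set g := φ.denom with hg
  set f := φ.num - C (value φ a) * g with hf
  have hfd : f.natDegree = d := by
    rw [hf, natDegree_sub_C_mul hdeg, ← hφ, RationalMap.degree, max_eq_left hdeg.le]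
  have hfg : g.natDegree < f.natDegree := by rwa [hf, natDegree_sub_C_mul hdeg]
  have hf0 : f ≠ 0 := by rintro h; rw [h] at hfd; simp at hfd; omega
  have hcop : IsCoprime f g := by
    have := (IsCoprime.add_mul_right_left_iff (z := -C (value φ a))).2 φ.isCoprime_num_denom
    rwa [neg_mul, ← sub_eq_add_neg] at this
  have hfe : ∀ z, g.eval z ≠ 0 → f.eval z = (value φ z - value φ a) * g.eval z := fun z hz => by
    rw [hf, eval_sub, eval_mul, eval_C, value_eq φ z, ← hg]
    field_simp
  have hW : derivative φ.num * g - φ.num * derivative g = derivative f * g - f * derivative g := by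
    rw [hf, derivative_sub, derivative_mul, derivative_C]
    ring
  have hfa : f.eval a = 0 := by rw [hfe a hga, sub_self, zero_mul]
  have hderiv : deriv (value φ) a = (derivative f).eval a / g.eval a := by
    rw [deriv_value hga, ← hg, hW, eval_sub, eval_mul, eval_mul, hfa]
    field_simp
    ring
  have hdfa : (derivative f).eval a ≠ 0 := fun h => hda (by rw [hderiv, h, zero_div])
  obtain ⟨μ, hμ, hμ1, hμd, hε⟩ := exists_epsilon_eq hd hchar
  -- `a` is a simple zero of `f`, whose degree is at least `2`.
  have hex : ∃ c, c ≠ a ∧ f.eval c = 0 := by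
    by_contra! h
    have hle : f.roots.toFinset ⊆ {a} := fun z hz => by
      by_contra hza
      exact h z (by simpa using hza) (isRoot_of_mem_roots (by simpa using hz))
    have hsub : f.roots ≤ {a} := by
      rw [Multiset.le_iff_count]
      intro z
      rw [Multiset.count_singleton]
      split_ifs with hz
      · rw [hz, count_roots]
        by_contra! h1
        exact hdfa (((one_lt_rootMultiplicity_iff_isRoot hf0).1 h1).2)
      · rw [Nat.le_zero, Multiset.count_eq_zero]
        exact fun hm => hz (by simpa using hle (Multiset.mem_toFinset.2 hm))
    have := Multiset.card_le_card hsub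
    rw [← (IsAlgClosed.splits f).natDegree_eq_card_roots, hfd] at this
    simp at this
    omega
  obtain ⟨c, hca, hc, hcr⟩ := exists_enorm_sub_le_of_isGreatest hga hr hf hf0 hex
  set ρ₀ : ℝ := (μ ^ d)⁻¹ * ‖c - a‖ * ‖deriv (value φ) a‖ with hρ₀
  have hca' : 0 < ‖c - a‖ := norm_pos_iff.2 (sub_ne_zero.2 hca)
  have hda' := norm_pos_iff.2 hda
  have hρ₀pos : 0 < ρ₀ := by positivity
  have hcrit₀ : ∀ y, g.eval y ≠ 0 → (derivative f * g - f * derivative g).eval y = 0 →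
      ρ₀ * ‖g.eval y‖ < ‖f.eval y‖ := fun y hy hAy => by
    have h1 := hcon y ((toMap_coe_ne_infty_iff φ y).2 hy)
      (by rw [deriv_value hy, ← hg, hW, hAy, zero_div])
    have h2 : ENNReal.ofReal ρ₀ < ENNReal.ofReal ‖value φ y - value φ a‖ := by
      rw [ofReal_norm]
      refine lt_of_le_of_lt ?_ h1
      rw [hρ₀, ENNReal.ofReal_mul (by positivity), ENNReal.ofReal_mul (by positivity),
        ofReal_norm, ofReal_norm, ENNReal.ofReal_inv_of_pos (by positivity), hε]
      gcongr
    rw [hfe y hy, norm_mul]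
    exact mul_lt_mul_of_pos_right ((ENNReal.ofReal_lt_ofReal_iff_of_nonneg hρ₀pos.le).1 h2)
      (norm_pos_iff.2 hy)
  have hA0 : derivative f * g - f * derivative g ≠ 0 := fun h => by
    have := congrArg (eval a) h
    simp [hfa, hdfa, hga] at this
  -- There are finitely many critical points, so the strict inequalities survive a slight increase
  -- of the radius; this makes the final inequality contradictory.
  obtain ⟨ρ, hρ, hρ₀lt⟩ : ∃ ρ, (∀ y ∈ (derivative f * g - f * derivative g).roots.toFinset,
      g.eval y ≠ 0 → ρ * ‖g.eval y‖ < ‖f.eval y‖) ∧ ρ₀ < ρ := by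
    refine (Filter.Eventually.and ((Finset.eventually_all _).2 fun y hy => ?_)
      (self_mem_nhdsWithin : Set.Ioi ρ₀ ∈ 𝓝[>] ρ₀)).exists
    by_cases hgy : g.eval y = 0
    · simp [hgy]
    · filter_upwards [eventually_nhdsGT_mul_lt
        (hcrit₀ y hgy (isRoot_of_mem_roots (by simpa using hy)))] with x hx _
      exact hx
  have key := sq_mul_le_norm_sub_mul hfg hcop hμ hμ1 (by rwa [hfd]) hfa hdfa hca hc
    (hρ₀pos.trans hρ₀lt) fun y hgy hAy => hρ y (by simpa [hA0] using hAy) hgy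
  have hga' := norm_pos_iff.2 hga
  have hlam : ‖(derivative f).eval a‖ = ‖deriv (value φ) a‖ * ‖g.eval a‖ := by
    rw [hderiv, norm_div]; field_simp
  rw [hlam, ← mul_assoc, ← mul_assoc] at key
  have key2 := le_of_mul_le_mul_right key hga'
  have hpow : μ ^ d ≤ μ ^ 2 := pow_le_pow_of_le_one hμ.le hμ1 hd
  have : ρ ≤ ρ₀ := by
    rw [hρ₀, mul_assoc, inv_mul_eq_div, le_div_iff₀ (by positivity), mul_comm]
    exact (mul_le_mul_of_nonneg_right hpow (hρ₀pos.trans hρ₀lt).le).trans key2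
  linarith
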